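/- **Theorem (the limit as $p\to\infty$).** Let $d\ge 1$, let $\Omega\subset\mathbb{R}^d$ be open and bounded, and let $g\in W^{1,\infty}(\Omega)$. For $1<p<\infty$ let $W^{1,p}_0(\Omega)$ be the closure of $C_c^\infty(\Omega)$ in $W^{1,p}(\Omega)$ and let $W^{1,p}_g(\Omega)$ be the set of $\varphi\in W^{1,p}(\Omega)$ with $\varphi=g$ on $\partial\Omega$, that is, with $\varphi-g\in W^{1,p}_0(\Omega)$. A function $u\in W^{1,p}_g(\Omega)$ is a weak solution of the Dirichlet problem $$\operatorname{div}\bigl(|Du|^{p-2}Du\bigr)=0 \text{ in }\Omega,\qquad u=g\text{ on }\partial\Omega,$$ if $\int_\Omega |Du|^{p-2}Du\cdot Dv\,dx=0$ for all $v\in W^{1,p}_0(\Omega)$. Let $(p_n)_{n\in\mathbb{N}}$ be a sequence in $(1,\infty)$ with $p_n\to\infty$ and, for each $n$, let $u_{p_n}\in W^{1,p_n}_g(\Omega)$ be a weak solution of this problem with $p=p_n$. Then there are a subsequence $(p_{n_j})_{j}$ and a continuous function $u_\infty\in W^{1,\infty}(\Omega)$ (called the candidate $\infty$-harmonic function) such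 that every $u_{p_{n_j}}$ has a continuous representative on $\Omega$ (again denoted $u_{p_{n_j}}$) and $$u_{p_{n_j}}\to u_\infty\quad\text{in }C^0,\quad\text{i.e. uniformly on }\Omega,\text{ as } j\to\infty.$$ -/

import Mathlib

open MeasureTheory Filter Topology TopologicalSpace
open scoped ENNReal Distributions

/-- `G` is the weak (distributional) gradient of `u` in the open set `Ω ⊆ ℝᵈ`: both are locally
integrable in `Ω` and `∫_Ω u ∇φ = - ∫_Ω φ G` for every smooth `φ` compactly supported in `Ω`. -/
def HasWeakGradient {d : ℕ} (Ω : Opens (EuclideanSpace ℝ (Fin d)))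
    (u : EuclideanSpace ℝ (Fin d) → ℝ)
    (G : EuclideanSpace ℝ (Fin d) → EuclideanSpace ℝ (Fin d)) : Prop :=
  LocallyIntegrableOn u (Ω : Set (EuclideanSpace ℝ (Fin d))) volume ∧
  LocallyIntegrableOn G (Ω : Set (EuclideanSpace ℝ (Fin d))) volume ∧
  ∀ φ : 𝓓(Ω, ℝ),
    ∫ x in (Ω : Set (EuclideanSpace ℝ (Fin d))), u x • gradient φ x =
      -∫ x in (Ω : Set (EuclideanSpace ℝ (Fin d))), φ x • G x

/-- `u ∈ W^{1,p}(Ω)` and `G ∈ Lᵖ(Ω)` is its weak gradient; here `1 ≤ p ≤ ∞`. -/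
def HasSobolevGradient {d : ℕ} (Ω : Opens (EuclideanSpace ℝ (Fin d))) (p : ℝ≥0∞)
    (u : EuclideanSpace ℝ (Fin d) → ℝ)
    (G : EuclideanSpace ℝ (Fin d) → EuclideanSpace ℝ (Fin d)) : Prop :=
  HasWeakGradient Ω u G ∧
  MemLp u p (volume.restrict (Ω : Set (EuclideanSpace ℝ (Fin d)))) ∧
  MemLp G p (volume.restrict (Ω : Set (EuclideanSpace ℝ (Fin d))))

/-- Membership in the Sobolev space `W^{1,p}(Ω)`. -/
def MemSobolev {d : ℕ} (Ω : Opens (EuclideanSpace ℝ (Fin d))) (p : ℝ≥0∞)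
    (u : EuclideanSpace ℝ (Fin d) → ℝ) : Prop :=
  ∃ G, HasSobolevGradient Ω p u G

/-- `v ∈ W^{1,p}_0(Ω)` with weak gradient `H`, where `W^{1,p}_0(Ω)` is the closure of
`C_c^∞(Ω)` in the norm of `W^{1,p}(Ω)`. -/
def HasSobolevZeroGradient {d : ℕ} (Ω : Opens (EuclideanSpace ℝ (Fin d))) (p : ℝ≥0∞)
    (v : EuclideanSpace ℝ (Fin d) → ℝ)
    (H : EuclideanSpace ℝ (Fin d) → EuclideanSpace ℝ (Fin d)) : Prop :=
  HasSobolevGradient Ω p v H ∧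
  ∀ ε : ℝ≥0∞, 0 < ε → ∃ φ : 𝓓(Ω, ℝ),
    eLpNorm (fun x => v x - φ x) p
      (volume.restrict (Ω : Set (EuclideanSpace ℝ (Fin d)))) < ε ∧
    eLpNorm (fun x => H x - gradient φ x) p
      (volume.restrict (Ω : Set (EuclideanSpace ℝ (Fin d)))) < ε

/-- Membership in `W^{1,p}_g(Ω)`: `u ∈ W^{1,p}(Ω)` and `u = g` on `∂Ω`, in the usual sense that
`u - g ∈ W^{1,p}_0(Ω)`. -/
def MemSobolevBdry {d : ℕ} (Ω : Opens (EuclideanSpace ℝ (Fin d))) (p : ℝ≥0∞)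
    (g u : EuclideanSpace ℝ (Fin d) → ℝ) : Prop :=
  MemSobolev Ω p u ∧ ∃ H, HasSobolevZeroGradient Ω p (fun x => u x - g x) H

/-- `u` is a weak solution of `div(|Du|^{p-2} Du) = 0` in `Ω`, `u = g` on `∂Ω`: `u ∈ W^{1,p}_g(Ω)`
and `∫_Ω |Du|^{p-2} Du · Dv = 0` for all `v ∈ W^{1,p}_0(Ω)`. Weak gradients are unique up to null
sets, so it does not matter which versions `G` of `Du` and `H` of `Dv` are used. -/
def IsWeakSolutionPLaplace {d : ℕ} (Ω : Opens (EuclideanSpace ℝ (Fin d))) (p : ℝ)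
    (g u : EuclideanSpace ℝ (Fin d) → ℝ) : Prop :=
  MemSobolevBdry Ω (ENNReal.ofReal p) g u ∧
  ∀ G, HasSobolevGradient Ω (ENNReal.ofReal p) u G →
    ∀ v H, HasSobolevZeroGradient Ω (ENNReal.ofReal p) v H →
      ∫ x in (Ω : Set (EuclideanSpace ℝ (Fin d))),
        inner ℝ (‖G x‖ ^ (p - 2) • G x) (H x) = 0

/-! ### Morrey's inequality with explicit dependence on p -/

section Morrey

variable {E F : Type*} [NormedAddCommGroup E] [InnerProductSpace ℝ E] [FiniteDimensional ℝ E]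
  [MeasurableSpace E] [BorelSpace E] [NormedAddCommGroup F]

open Module

/-! Let L be the sup norm of Dg. Testing the equation with u_p - g and applying Young's inequality
gives ‖Du_p‖_p ≤ L|Ω|^{1/p}, hence ‖D(u_p - g)‖_p ≤ 2L|Ω|^{1/p}
(`IsWeakSolutionPLaplace.exists_gradient_bound`).

Since u_p - g is a limit of test functions, it extends by zero to the whole space, so no regularity
of ∂Ω is needed. For p > d, Morrey's inequality makes this extension Hölder with exponent 1 - d/p,
and its constant stays bounded as p → ∞ (`abs_sub_le_of_compactSupport`,
`HasSobolevZeroGradient.exists_holder_representative`). For p ≥ 2d the exponents are at least 1/2,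
so the family is equicontinuous and Arzelà–Ascoli applies on the closure of Ω. The exponents tend to
1, so the limit is Lipschitz and therefore in W^{1,∞} (`exists_subseq_tendstoUniformlyOn_of_holder`,
`LipschitzWith.memSobolev_top`).

It remains to add g back. On an arbitrary open set g need not be globally Lipschitz, so a continuous
representative is built locally by mollification
(`HasSobolevGradient.exists_continuousOn_representative`). It is the same for all p and cancels in
the uniform convergence. -/

theorem eLpNorm_comp_add_smul {f : E → F} (hf : Continuous f) (x : E) {t p : ℝ} (ht : 0 < t)
    (hp : 1 ≤ p) :
    eLpNorm (fun w => f (x + t • w)) (ENNReal.ofReal p) volume =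
      ENNReal.ofReal (t ^ (-(finrank ℝ E / p))) * eLpNorm f (ENNReal.ofReal p) volume := by
  have hmap : Measure.map (fun w : E => x + t • w) volume =
      ENNReal.ofReal |(t ^ finrank ℝ E)⁻¹| • volume := by
    have h : (fun w : E => x + t • w) = (fun w => x + w) ∘ (fun w => t • w) := rfl
    rw [h, ← Measure.map_map (by fun_prop) (by fun_prop), Measure.map_addHaar_smul volume ht.ne',
      Measure.map_smul, (measurePreserving_add_left (volume : Measure E) x).map_eq]
  have hc : 0 < |(t ^ finrank ℝ E)⁻¹| := by positivity
  have := eLpNorm_map_measure (μ := (volume : Measure E)) (f := fun w : E => x + t • w)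
    (p := ENNReal.ofReal p) hf.aestronglyMeasurable (by fun_prop)
  rw [hmap, eLpNorm_smul_measure_of_ne_top ENNReal.ofReal_ne_top] at this
  refine this.symm.trans ?_
  rw [one_div, ENNReal.toReal_inv, ENNReal.toReal_ofReal (by linarith), ENNReal.ofReal_rpow_of_pos hc,
    smul_eq_mul]
  congr 2
  rw [abs_of_pos (by positivity), ← Real.rpow_natCast, ← Real.rpow_neg ht.le,
    ← Real.rpow_mul ht.le]
  congr 1; ring

/-- Hölder on S combined with scaling. The factor t^(-d/p) is integrable at t = 0 exactly when p >
d, which is where Morrey's condition enters. -/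
theorem setLIntegral_enorm_comp_add_smul_le {f : E → F} (hf : Continuous f) (x : E) {t p : ℝ}
    (ht : 0 < t) (hp : 1 ≤ p) (S : Set E) :
    ∫⁻ w in S, ‖f (x + t • w)‖ₑ ≤
      ENNReal.ofReal (t ^ (-(finrank ℝ E / p))) * (eLpNorm f (ENNReal.ofReal p) volume *
        volume S ^ (1 - 1 / p)) := by
  have hc : Continuous (fun w => f (x + t • w)) := by fun_prop
  rw [← eLpNorm_one_eq_lintegral_enorm]
  have h1 : (1 : ℝ≥0∞) ≤ ENNReal.ofReal p := by simpa using hp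
  refine (eLpNorm_le_eLpNorm_mul_rpow_measure_univ h1 hc.aestronglyMeasurable).trans ?_
  rw [← mul_assoc, ← eLpNorm_comp_add_smul hf x ht hp]
  rw [Measure.restrict_apply_univ, ENNReal.toReal_one, ENNReal.toReal_ofReal (by linarith), div_one]
  gcongr
  exact Measure.restrict_le_self

theorem lintegral_Ioo_rpow_neg {a : ℝ} (ha : a < 1) :
    ∫⁻ t in Set.Ioo (0 : ℝ) 1, ENNReal.ofReal (t ^ (-a)) = ENNReal.ofReal (1 / (1 - a)) := by
  have hi : IntegrableOn (fun t : ℝ => t ^ (-a)) (Set.Ioo 0 1) := by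
    rw [intervalIntegral.integrableOn_Ioo_rpow_iff one_pos]; linarith
  rw [← ofReal_integral_eq_lintegral_ofReal hi]
  · rw [← integral_Ioc_eq_integral_Ioo, ← intervalIntegral.integral_of_le zero_le_one,
      integral_rpow (Or.inl (by linarith)), Real.one_rpow, Real.zero_rpow (by linarith)]
    congr 1; rw [sub_zero]; congr 1; ring
  · filter_upwards [ae_restrict_mem measurableSet_Ioo] with t ht
    exact Real.rpow_nonneg ht.1.le _

omit [FiniteDimensional ℝ E] [MeasurableSpace E] [BorelSpace E] in
theorem enorm_sub_le_lintegral_fderiv {φ : E → ℝ} (hφ : ContDiff ℝ 1 φ) (x w : E) :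
    ‖φ (x + w) - φ x‖ₑ ≤ ∫⁻ t in Set.Ioo (0 : ℝ) 1, ‖fderiv ℝ φ (x + t • w)‖ₑ * ‖w‖ₑ := by
  have hd : ∀ t : ℝ, HasDerivAt (fun t : ℝ => φ (x + t • w)) (fderiv ℝ φ (x + t • w) w) t := by
    intro t
    have h1 : HasDerivAt (fun t : ℝ => x + t • w) w t := by
      simpa using ((hasDerivAt_id t).smul_const w).const_add x
    exact ((hφ.differentiable one_ne_zero _).hasFDerivAt).comp_hasDerivAt t h1
  have hcf : Continuous (fderiv ℝ φ) := hφ.continuous_fderiv one_ne_zero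
  have hc : Continuous (fun t : ℝ => fderiv ℝ φ (x + t • w) w) := by fun_prop
  have := intervalIntegral.integral_eq_sub_of_hasDerivAt (a := 0) (b := 1) (fun t _ => hd t)
    (hc.intervalIntegrable _ _)
  simp only [one_smul, zero_smul, add_zero] at this
  rw [← this, intervalIntegral.integral_of_le zero_le_one, integral_Ioc_eq_integral_Ioo]
  refine (enorm_integral_le_lintegral_enorm _).trans (lintegral_mono fun t => ?_)
  exact ContinuousLinearMap.le_opENorm _ _

/-- Integrate the derivative along segments from x and exchange the two integrals. S need not be
centred at 0, so that one ball can be viewed from two different base points. -/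
theorem setLIntegral_enorm_sub_le {φ : E → ℝ} (hφ : ContDiff ℝ 1 φ) (x : E) {p R : ℝ}
    (hp : 1 ≤ p) (hpd : finrank ℝ E < p) {S : Set E} (hS : MeasurableSet S)
    (hR : ∀ w ∈ S, ‖w‖ ≤ R) :
    ∫⁻ w in S, ‖φ (x + w) - φ x‖ₑ ≤ ENNReal.ofReal (1 / (1 - finrank ℝ E / p)) *
      (eLpNorm (fderiv ℝ φ) (ENNReal.ofReal p) volume * volume S ^ (1 - 1 / p)) *
        ENNReal.ofReal R := by
  have hcf : Continuous (fderiv ℝ φ) := hφ.continuous_fderiv one_ne_zero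
  have hm : Measurable (fun q : E × ℝ => ‖fderiv ℝ φ (x + q.2 • q.1)‖ₑ) :=
    (by fun_prop : Continuous (fun q : E × ℝ => fderiv ℝ φ (x + q.2 • q.1))).enorm.measurable
  calc ∫⁻ w in S, ‖φ (x + w) - φ x‖ₑ
      ≤ ∫⁻ w in S, (∫⁻ t in Set.Ioo (0 : ℝ) 1, ‖fderiv ℝ φ (x + t • w)‖ₑ) * ENNReal.ofReal R := by
        refine setLIntegral_mono' hS fun w hw => ?_
        refine (enorm_sub_le_lintegral_fderiv hφ x w).trans ?_
        rw [← lintegral_mul_const' _ _ ENNReal.ofReal_ne_top]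
        refine lintegral_mono fun t => ?_
        gcongr
        rw [← ofReal_norm]
        exact ENNReal.ofReal_le_ofReal (hR w hw)
    _ = (∫⁻ t in Set.Ioo (0 : ℝ) 1, ∫⁻ w in S, ‖fderiv ℝ φ (x + t • w)‖ₑ) * ENNReal.ofReal R := by
        rw [lintegral_mul_const' _ _ ENNReal.ofReal_ne_top, lintegral_lintegral_swap]
        exact hm.aemeasurable
    _ ≤ (∫⁻ t in Set.Ioo (0 : ℝ) 1, ENNReal.ofReal (t ^ (-(finrank ℝ E / p))) *
          (eLpNorm (fderiv ℝ φ) (ENNReal.ofReal p) volume *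
        volume S ^ (1 - 1 / p))) * ENNReal.ofReal R := by
        gcongr ?_ * _
        exact setLIntegral_mono' measurableSet_Ioo fun t ht =>
          setLIntegral_enorm_comp_add_smul_le hcf x ht.1 hp S
    _ = _ := by
        rw [lintegral_mul_const _ (by fun_prop), lintegral_Ioo_rpow_neg]
        rw [div_lt_one (by linarith)]; exact hpd

/-- Morrey's inequality for compactly supported `C¹` functions, with a constant that stays bounded
as `p → ∞`. -/
theorem abs_sub_le_of_compactSupport {φ : E → ℝ} (hφ : ContDiff ℝ 1 φ) (hs : HasCompactSupport φ)
    {p : ℝ} (hp : 1 ≤ p) (hpd : finrank ℝ E < p) (x y : E) :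
    |φ x - φ y| ≤ 3 / (1 - finrank ℝ E / p) *
      (volume (Metric.ball (0 : E) 1)).toReal ^ (-(1 / p)) * ‖x - y‖ ^ (1 - finrank ℝ E / p) *
        (eLpNorm (fderiv ℝ φ) (ENNReal.ofReal p) volume).toReal := by
  have hcf : Continuous (fderiv ℝ φ) := hφ.continuous_fderiv one_ne_zero
  set N := eLpNorm (fderiv ℝ φ) (ENNReal.ofReal p) volume with hN
  have hNt : N ≠ ∞ := (hcf.memLp_of_hasCompactSupport (hs.fderiv ℝ)).eLpNorm_ne_top
  have ha : 0 < 1 - finrank ℝ E / p := by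
    rw [sub_pos, div_lt_one (by linarith)]; exact hpd
  rcases eq_or_ne x y with rfl | hxy
  · simp [Real.zero_rpow ha.ne']
  set r := ‖x - y‖ with hr
  have hr0 : 0 < r := norm_pos_iff.2 (sub_ne_zero.2 hxy)
  set V := volume (Metric.ball (0 : E) r) with hV
  have hV0 : V ≠ 0 := (Metric.measure_ball_pos _ _ hr0).ne'
  have hVt : V ≠ ∞ := measure_ball_lt_top.ne
  set c := ENNReal.ofReal (1 / (1 - finrank ℝ E / p)) with hc
  have h1 := setLIntegral_enorm_sub_le hφ x hp hpd (S := Metric.ball 0 r) (R := r)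
    measurableSet_ball (fun w hw => (mem_ball_zero_iff.1 hw).le)
  -- The ball of radius r about x, seen from y: its points are within 2r of y. Together with the r
  -- from `h1` this produces the constant 3.
  have h2 := setLIntegral_enorm_sub_le hφ y hp hpd (S := Metric.ball (x - y) r) (R := 2 * r)
    measurableSet_ball (fun w hw => by
      have := norm_le_norm_add_norm_sub' w (x - y)
      rw [mem_ball_iff_norm] at hw; linarith)
  rw [Measure.addHaar_ball_center] at h2
  have h3 : ∫⁻ w in Metric.ball (x - y) r, ‖φ (y + w) - φ y‖ₑ =
      ∫⁻ w in Metric.ball 0 r, ‖φ (x + w) - φ y‖ₑ := by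
    have hmp : MeasurePreserving (fun w : E => (x - y) + w) := measurePreserving_add_left _ _
    have he : MeasurableEmbedding (fun w : E => (x - y) + w) := measurableEmbedding_addLeft _
    rw [← hmp.setLIntegral_comp_preimage_emb he]
    have : (fun w : E => (x - y) + w) ⁻¹' Metric.ball (x - y) r = Metric.ball 0 r := by
      ext w; simp
    rw [this]
    refine lintegral_congr fun w => ?_
    congr 3; abel
  rw [h3] at h2
  -- Average the triangle inequality through the intermediate value φ (x + w) over w in the ball.
  have h4 : V * ‖φ x - φ y‖ₑ ≤ c * (N * V ^ (1 - 1 / p)) * ENNReal.ofReal (3 * r) := by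
    calc V * ‖φ x - φ y‖ₑ = ∫⁻ w in Metric.ball (0 : E) r, ‖φ x - φ y‖ₑ := by
          rw [setLIntegral_const, mul_comm]
      _ ≤ ∫⁻ w in Metric.ball (0 : E) r, (‖φ (x + w) - φ x‖ₑ + ‖φ (x + w) - φ y‖ₑ) := by
          refine lintegral_mono fun w => ?_
          have : φ x - φ y = -(φ (x + w) - φ x) + (φ (x + w) - φ y) := by ring
          rw [this]
          refine (enorm_add_le _ _).trans (by rw [enorm_neg])
      _ = _ := lintegral_add_left (by
          have := hφ.continuous
          exact (by fun_prop : Continuous fun w => φ (x + w) - φ x).enorm.measurable) _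
      _ ≤ _ := add_le_add h1 h2
      _ = _ := by
          rw [← mul_add, ← ENNReal.ofReal_add hr0.le (by linarith)]
          congr 2; ring
  have h5 := ENNReal.toReal_mono (by
    refine ENNReal.mul_ne_top (ENNReal.mul_ne_top ENNReal.ofReal_ne_top (ENNReal.mul_ne_top hNt ?_))
      ENNReal.ofReal_ne_top
    exact ENNReal.rpow_ne_top_of_ne_zero hV0 hVt) h4
  simp only [ENNReal.toReal_mul, hc, toReal_enorm, ← ENNReal.toReal_rpow] at h5
  rw [ENNReal.toReal_ofReal (by positivity), ENNReal.toReal_ofReal (by positivity)] at h5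
  set v := V.toReal with hv
  have hv0 : 0 < v := ENNReal.toReal_pos hV0 hVt
  have hvr : v = r ^ finrank ℝ E * (volume (Metric.ball (0 : E) 1)).toReal := by
    rw [hv, hV, Measure.addHaar_ball_of_pos _ _ hr0, ENNReal.toReal_mul,
      ENNReal.toReal_ofReal (by positivity)]
  have hω : 0 ≤ (volume (Metric.ball (0 : E) 1)).toReal := ENNReal.toReal_nonneg
  have hsp : v ^ (1 - 1 / p) = v * v ^ (-(1 / p)) := by
    rw [sub_eq_add_neg, Real.rpow_add hv0, Real.rpow_one]
  have hsr : r * v ^ (-(1 / p)) = (volume (Metric.ball (0 : E) 1)).toReal ^ (-(1 / p)) *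
      r ^ (1 - finrank ℝ E / p) := by
    rw [hvr, Real.mul_rpow (by positivity) hω, ← Real.rpow_natCast, ← Real.rpow_mul hr0.le,
      sub_eq_add_neg, Real.rpow_add hr0, Real.rpow_one]
    rw [show (finrank ℝ E : ℝ) * -(1 / p) = -(finrank ℝ E / p) by ring]; ring
  have h6 : v * |φ x - φ y| ≤ v * (3 / (1 - finrank ℝ E / p) * (r * v ^ (-(1 / p))) * N.toReal) := by
    rw [← Real.norm_eq_abs]
    refine h5.trans (le_of_eq ?_)
    rw [hsp]; ring
  have h7 := le_of_mul_le_mul_left h6 hv0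
  rw [hsr] at h7
  refine h7.trans (le_of_eq (by ring))

end Morrey

/-! ### From test functions to Hölder representatives in W^{1,p}_0 -/

section TestFunctions

variable {d : ℕ} {Ω : Opens (EuclideanSpace ℝ (Fin d))}

theorem norm_gradient_eq_norm_fderiv {E : Type*} [NormedAddCommGroup E] [InnerProductSpace ℝ E]
    [CompleteSpace E] (f : E → ℝ) (x : E) : ‖gradient f x‖ = ‖fderiv ℝ f x‖ := by
  simp [gradient]

theorem TestFunction.continuous_gradient (φ : 𝓓(Ω, ℝ)) : Continuous (gradient φ) :=
  (InnerProductSpace.toDual ℝ _).symm.continuous.comp (φ.contDiff.continuous_fderiv (by simp))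

theorem TestFunction.hasCompactSupport_gradient (φ : 𝓓(Ω, ℝ)) : HasCompactSupport (gradient φ) :=
  (φ.hasCompactSupport.fderiv ℝ).comp_left (map_zero _)

theorem TestFunction.differentiable (φ : 𝓓(Ω, ℝ)) : Differentiable ℝ φ :=
  φ.contDiff.differentiable (by simp)

theorem TestFunction.gradient_sub (φ ψ : 𝓓(Ω, ℝ)) (x : EuclideanSpace ℝ (Fin d)) :
    gradient (φ - ψ : 𝓓(Ω, ℝ)) x = gradient φ x - gradient ψ x := by
  simp only [gradient, FunLike.coe_sub]
  rw [fderiv_sub φ.differentiable.differentiableAt ψ.differentiable.differentiableAt, map_sub]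

theorem TestFunction.apply_eq_zero_of_notMem (φ : 𝓓(Ω, ℝ)) {x : EuclideanSpace ℝ (Fin d)}
    (hx : x ∉ Ω) : φ x = 0 :=
  image_eq_zero_of_notMem_tsupport fun h => hx (φ.tsupport_subset h)

theorem TestFunction.gradient_eq_zero_of_notMem (φ : 𝓓(Ω, ℝ)) {x : EuclideanSpace ℝ (Fin d)}
    (hx : x ∉ Ω) : gradient φ x = 0 := by
  have : fderiv ℝ φ x = 0 := by
    by_contra h
    exact hx (φ.tsupport_subset (support_fderiv_subset ℝ h))
  simp [gradient, this]

theorem TestFunction.abs_sub_le (φ : 𝓓(Ω, ℝ)) {p : ℝ} (hp : 1 ≤ p) (hpd : d < p)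
    (x y : EuclideanSpace ℝ (Fin d)) :
    |φ x - φ y| ≤ 3 / (1 - d / p) *
      (volume (Metric.ball (0 : EuclideanSpace ℝ (Fin d)) 1)).toReal ^ (-(1 / p)) *
        ‖x - y‖ ^ (1 - d / p) *
        (eLpNorm (gradient φ) (ENNReal.ofReal p) (volume.restrict Ω)).toReal := by
  have h := abs_sub_le_of_compactSupport (φ.contDiff.of_le (by simp)) φ.hasCompactSupport
    hp (by simpa using hpd) x y
  rw [finrank_euclideanSpace_fin] at h
  rwa [eLpNorm_restrict_eq_of_support_subset, eLpNorm_congr_norm_ae (g := fderiv ℝ φ)]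
  · exact ae_of_all _ fun x => norm_gradient_eq_norm_fderiv _ x
  · intro x hx
    by_contra hxΩ
    exact hx (φ.gradient_eq_zero_of_notMem hxΩ)

/-- For `p > d`, a function in `W^{1,p}_0(Ω)` has a Hölder continuous representative that vanishes
outside `Ω`. -/
theorem HasSobolevZeroGradient.exists_holder_representative {p : ℝ} (hp : 1 ≤ p) (hpd : d < p)
    {v : EuclideanSpace ℝ (Fin d) → ℝ} {H : EuclideanSpace ℝ (Fin d) → EuclideanSpace ℝ (Fin d)}
    (h : HasSobolevZeroGradient Ω (ENNReal.ofReal p) v H)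
    {y₀ : EuclideanSpace ℝ (Fin d)} (hy₀ : y₀ ∉ Ω) :
    ∃ w : EuclideanSpace ℝ (Fin d) → ℝ,
      w =ᵐ[volume.restrict (Ω : Set (EuclideanSpace ℝ (Fin d)))] v ∧ (∀ x ∉ Ω, w x = 0) ∧
      ∀ x y, |w x - w y| ≤ 3 / (1 - d / p) *
        (volume (Metric.ball (0 : EuclideanSpace ℝ (Fin d)) 1)).toReal ^ (-(1 / p)) *
        ‖x - y‖ ^ (1 - d / p) *
        (eLpNorm H (ENNReal.ofReal p)
          (volume.restrict (Ω : Set (EuclideanSpace ℝ (Fin d))))).toReal := by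
  obtain ⟨⟨_, hv, hH⟩, happ⟩ := h
  set q := ENNReal.ofReal p with hq
  have hq1 : 1 ≤ q := by simpa [hq] using hp
  set μ := volume.restrict (Ω : Set (EuclideanSpace ℝ (Fin d))) with hμ
  set A : EuclideanSpace ℝ (Fin d) → EuclideanSpace ℝ (Fin d) → ℝ := fun x y => 3 / (1 - d / p) *
      (volume (Metric.ball (0 : EuclideanSpace ℝ (Fin d)) 1)).toReal ^ (-(1 / p)) *
        ‖x - y‖ ^ (1 - d / p) with hA
  have hA0 : ∀ x y, 0 ≤ A x y := fun x y => by
    have : 0 ≤ 1 - d / p := by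
      rw [sub_nonneg, div_le_one (by linarith)]; exact hpd.le
    have : 0 ≤ 3 / (1 - d / p) := by positivity
    simp only [hA]; positivity
  set e : ℕ → ℝ := fun k => 1 / ((k : ℝ) + 1) with he
  have he0 : ∀ k, 0 < e k := fun k => by simp only [he]; positivity
  have het : Tendsto e atTop (𝓝 0) := tendsto_one_div_add_atTop_nhds_zero_nat
  choose φ hφ1 hφ2 using fun k => happ (ENNReal.ofReal (e k)) (ENNReal.ofReal_pos.2 (he0 k))
  have hgm : ∀ k, AEStronglyMeasurable (gradient (φ k)) μ := fun k =>
    (φ k).continuous_gradient.aestronglyMeasurable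
  have hdiff : ∀ k l, eLpNorm (gradient (φ k - φ l : 𝓓(Ω, ℝ))) q μ ≤ ENNReal.ofReal (e k + e l) := by
    intro k l
    have : (gradient (φ k - φ l : 𝓓(Ω, ℝ))) =
        (fun x => H x - gradient (φ l) x) - (fun x => H x - gradient (φ k) x) := by
      ext1 x
      rw [TestFunction.gradient_sub, Pi.sub_apply]; abel
    rw [this]
    refine (eLpNorm_sub_le (hH.1.sub (hgm l)) (hH.1.sub (hgm k)) hq1).trans ?_
    rw [add_comm (e k), ENNReal.ofReal_add (he0 l).le (he0 k).le]
    exact add_le_add (hφ2 l).le (hφ2 k).le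
  -- All test functions vanish at y₀, so the Hölder bound for φ n - φ m between x and y₀ controls
  -- its value at x. Convergence is thus pointwise everywhere, not merely almost everywhere.
  have hcauchy : ∀ x, CauchySeq (fun k => φ k x) := by
    intro x
    refine cauchySeq_of_le_tendsto_0 (fun N => A x y₀ * (2 * e N)) (fun n m N hn hm => ?_) ?_
    · have h1 := TestFunction.abs_sub_le (φ n - φ m) hp hpd x y₀
      simp only [FunLike.coe_sub, Pi.sub_apply, (φ n).apply_eq_zero_of_notMem hy₀,
        (φ m).apply_eq_zero_of_notMem hy₀, sub_zero] at h1
      rw [Real.dist_eq]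
      refine h1.trans (mul_le_mul_of_nonneg_left ?_ (hA0 x y₀))
      have hmono : ∀ a, N ≤ a → e a ≤ e N := fun a ha => by
        simp only [he]; gcongr
      have h2 := ENNReal.toReal_mono ENNReal.ofReal_ne_top (hdiff n m)
      rw [ENNReal.toReal_ofReal (by linarith [he0 n, he0 m])] at h2
      simp only [FunLike.coe_sub] at h2
      linarith [hmono n hn, hmono m hm]
    · simpa using (het.const_mul 2).const_mul (A x y₀)
  choose w hw using fun x => cauchySeq_tendsto_of_complete (hcauchy x)
  refine ⟨w, ?_, fun x hx => ?_, fun x y => ?_⟩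
  · have hm : TendstoInMeasure μ (fun k => (φ k : EuclideanSpace ℝ (Fin d) → ℝ)) atTop v := by
      refine tendstoInMeasure_of_tendsto_eLpNorm (p := q) (by positivity)
        (fun k => (φ k).continuous.aestronglyMeasurable) hv.1 ?_
      have hz : Tendsto (fun k => ENNReal.ofReal (e k)) atTop (𝓝 0) := by
        simpa using ENNReal.tendsto_ofReal het
      refine tendsto_of_tendsto_of_tendsto_of_le_of_le tendsto_const_nhds hz (fun _ => zero_le) ?_
      intro k
      dsimp only
      rw [eLpNorm_sub_comm]
      exact (hφ1 k).le
    obtain ⟨ns, hns, hae⟩ := hm.exists_seq_tendsto_ae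
    filter_upwards [hae] with x hx
    exact tendsto_nhds_unique ((hw x).comp hns.tendsto_atTop) hx
  · refine tendsto_nhds_unique (hw x) ?_
    simp only [fun k => (φ k).apply_eq_zero_of_notMem hx, tendsto_const_nhds_iff]
  · have hlim : Tendsto (fun k => A x y * ((eLpNorm H q μ).toReal + e k)) atTop
        (𝓝 (A x y * (eLpNorm H q μ).toReal)) := by
      simpa using (het.const_add (eLpNorm H q μ).toReal).const_mul (A x y)
    refine le_of_tendsto_of_tendsto' (((hw x).sub (hw y)).abs) hlim fun k => ?_
    refine ((φ k).abs_sub_le hp hpd x y).trans (mul_le_mul_of_nonneg_left ?_ (hA0 x y))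
    have h1 : eLpNorm (gradient (φ k)) q μ ≤ eLpNorm H q μ + ENNReal.ofReal (e k) := by
      have : (gradient (φ k)) = H - (fun x => H x - gradient (φ k) x) := by
        ext1 x; simp
      rw [this]
      refine (eLpNorm_sub_le hH.1 (hH.1.sub (hgm k)) hq1).trans ?_
      gcongr
      exact (hφ2 k).le
    have h2 := ENNReal.toReal_mono (ENNReal.add_ne_top.2 ⟨hH.2.ne, ENNReal.ofReal_ne_top⟩) h1
    rwa [ENNReal.toReal_add hH.2.ne ENNReal.ofReal_ne_top, ENNReal.toReal_ofReal (he0 k).le] at h2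

end TestFunctions

/-! ### Sobolev calculus and the energy estimate -/

section Sobolev

variable {d : ℕ} {Ω : Opens (EuclideanSpace ℝ (Fin d))}
  {u v : EuclideanSpace ℝ (Fin d) → ℝ} {G H : EuclideanSpace ℝ (Fin d) → EuclideanSpace ℝ (Fin d)}

theorem integrableOn_smul_of_locallyIntegrableOn {F : Type*} [NormedAddCommGroup F]
    [NormedSpace ℝ F] {f : EuclideanSpace ℝ (Fin d) → F} {a : EuclideanSpace ℝ (Fin d) → ℝ}
    (hf : LocallyIntegrableOn f (Ω : Set (EuclideanSpace ℝ (Fin d))) volume) (ha : Continuous a)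
    (hac : HasCompactSupport a) (haΩ : tsupport a ⊆ Ω) :
    IntegrableOn (fun x => a x • f x) (Ω : Set (EuclideanSpace ℝ (Fin d))) volume := by
  have h1 : IntegrableOn f (tsupport a) := hf.integrableOn_compact_subset haΩ hac
  have h2 : IntegrableOn (fun x => a x • f x) (tsupport a) :=
    h1.continuousOn_smul ha.continuousOn hac
  refine h2.of_forall_sdiff_eq_zero Ω.isOpen.measurableSet fun x hx => ?_
  rw [image_eq_zero_of_notMem_tsupport hx.2, zero_smul]

theorem integrableOn_smul_of_locallyIntegrableOn' {F : Type*} [NormedAddCommGroup F]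
    [NormedSpace ℝ F] {f : EuclideanSpace ℝ (Fin d) → ℝ} {a : EuclideanSpace ℝ (Fin d) → F}
    (hf : LocallyIntegrableOn f (Ω : Set (EuclideanSpace ℝ (Fin d))) volume) (ha : Continuous a)
    (hac : HasCompactSupport a) (haΩ : tsupport a ⊆ Ω) :
    IntegrableOn (fun x => f x • a x) (Ω : Set (EuclideanSpace ℝ (Fin d))) volume := by
  have h1 : IntegrableOn f (tsupport a) := hf.integrableOn_compact_subset haΩ hac
  have h2 : IntegrableOn (fun x => f x • a x) (tsupport a) :=
    h1.smul_continuousOn ha.continuousOn hac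
  refine h2.of_forall_sdiff_eq_zero Ω.isOpen.measurableSet fun x hx => ?_
  rw [image_eq_zero_of_notMem_tsupport hx.2, smul_zero]

theorem TestFunction.tsupport_gradient_subset (φ : 𝓓(Ω, ℝ)) : tsupport (gradient φ) ⊆ Ω := by
  refine subset_trans ?_ φ.tsupport_subset
  refine closure_minimal (fun x hx => ?_) (isClosed_tsupport _)
  by_contra h
  refine hx ?_
  have : fderiv ℝ φ x = 0 := by
    by_contra h'
    exact h (support_fderiv_subset ℝ h')
  simp [gradient, this]

theorem HasWeakGradient.add (hu : HasWeakGradient Ω u G) (hv : HasWeakGradient Ω v H) :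
    HasWeakGradient Ω (fun x => u x + v x) (fun x => G x + H x) := by
  refine ⟨hu.1.add hv.1, hu.2.1.add hv.2.1, fun φ => ?_⟩
  have iu := integrableOn_smul_of_locallyIntegrableOn' hu.1 φ.continuous_gradient
    φ.hasCompactSupport_gradient φ.tsupport_gradient_subset
  have iv := integrableOn_smul_of_locallyIntegrableOn' hv.1 φ.continuous_gradient
    φ.hasCompactSupport_gradient φ.tsupport_gradient_subset
  have iG := integrableOn_smul_of_locallyIntegrableOn hu.2.1 φ.continuous
    φ.hasCompactSupport φ.tsupport_subset
  have iH := integrableOn_smul_of_locallyIntegrableOn hv.2.1 φ.continuous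
    φ.hasCompactSupport φ.tsupport_subset
  simp only [add_smul, smul_add]
  rw [integral_add iu iv, integral_add iG iH, hu.2.2 φ, hv.2.2 φ, neg_add]

theorem HasSobolevGradient.add {p : ℝ≥0∞} (hu : HasSobolevGradient Ω p u G)
    (hv : HasSobolevGradient Ω p v H) :
    HasSobolevGradient Ω p (fun x => u x + v x) (fun x => G x + H x) :=
  ⟨hu.1.add hv.1, hu.2.1.add hv.2.1, hu.2.2.add hv.2.2⟩

theorem HasWeakGradient.congr (hu : HasWeakGradient Ω u G)
    (h : u =ᵐ[volume.restrict (Ω : Set (EuclideanSpace ℝ (Fin d)))] v) : HasWeakGradient Ω v G := by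
  refine ⟨fun x hx => ?_, hu.2.1, fun φ => ?_⟩
  · obtain ⟨s, hs, hi⟩ := hu.1 x hx
    exact ⟨s ∩ Ω, inter_mem hs self_mem_nhdsWithin, (hi.mono_set Set.inter_subset_left).congr
      (ae_restrict_of_ae_restrict_of_subset Set.inter_subset_right h)⟩
  rw [← hu.2.2 φ]
  refine integral_congr_ae ?_
  filter_upwards [h] with x hx
  rw [hx]

theorem HasSobolevGradient.congr {p : ℝ≥0∞} (hu : HasSobolevGradient Ω p u G)
    (h : u =ᵐ[volume.restrict (Ω : Set (EuclideanSpace ℝ (Fin d)))] v) :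
    HasSobolevGradient Ω p v G :=
  ⟨hu.1.congr h, hu.2.1.ae_eq h, hu.2.2⟩

theorem HasSobolevGradient.mono_exponent {p q : ℝ≥0∞}
    (hΩ : volume (Ω : Set (EuclideanSpace ℝ (Fin d))) ≠ ∞)
    (hu : HasSobolevGradient Ω q u G) (hpq : p ≤ q) : HasSobolevGradient Ω p u G := by
  have : IsFiniteMeasure (volume.restrict (Ω : Set (EuclideanSpace ℝ (Fin d)))) :=
    isFiniteMeasure_restrict.2 hΩ
  exact ⟨hu.1, hu.2.1.mono_exponent hpq, hu.2.2.mono_exponent hpq⟩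

/-- Convexity of the p-th power of the norm, obtained from Young's inequality for L · ‖a‖^(p-1).
Multiplying by p leaves (p-1)‖a‖^p to absorb, so one copy of ‖a‖^p survives. -/
theorem norm_rpow_le_inner_add {E : Type*} [NormedAddCommGroup E] [InnerProductSpace ℝ E]
    {p L : ℝ} (hp : 1 < p) (hL : 0 ≤ L) (a b : E) (hb : ‖b‖ ≤ L) :
    ‖a‖ ^ p ≤ p * inner ℝ (‖a‖ ^ (p - 2) • a) (a - b) + L ^ p := by
  have hp0 : 0 < p := by linarith
  rcases eq_or_ne a 0 with rfl | ha
  · simp only [norm_zero, Real.zero_rpow hp0.ne', smul_zero, inner_zero_left, mul_zero, zero_add]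
    positivity
  have hn : 0 < ‖a‖ := norm_pos_iff.2 ha
  have hq := Real.HolderConjugate.conjExponent hp
  have hy := Real.young_inequality_of_nonneg hL (Real.rpow_nonneg hn.le (p - 1)) hq
  rw [← Real.rpow_mul hn.le, hq.sub_one_mul_conj] at hy
  have h1 : inner ℝ (‖a‖ ^ (p - 2) • a) (a - b) = ‖a‖ ^ p - ‖a‖ ^ (p - 2) * inner ℝ a b := by
    rw [inner_sub_right, real_inner_smul_left, real_inner_smul_left, real_inner_self_eq_norm_sq,
      ← Real.rpow_natCast, ← Real.rpow_add hn]
    norm_num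
  have h2 : ‖a‖ ^ (p - 2) * inner ℝ a b ≤ L * ‖a‖ ^ (p - 1) := by
    have h3 : inner ℝ a b ≤ ‖a‖ * L := (real_inner_le_norm a b).trans (by gcongr)
    have h4 : ‖a‖ ^ (p - 1) = ‖a‖ ^ (p - 2) * ‖a‖ := by
      rw [← Real.rpow_add_one hn.ne']; ring_nf
    rw [h4]
    calc _ ≤ ‖a‖ ^ (p - 2) * (‖a‖ * L) := by gcongr
      _ = _ := by ring
  have h5 : (Real.conjExponent p)⁻¹ = 1 - p⁻¹ := by
    have := hq.inv_add_inv_eq_one; linarith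
  rw [div_eq_mul_inv _ (Real.conjExponent p), h5] at hy
  have h6 := mul_le_mul_of_nonneg_left (h2.trans hy) hp0.le
  rw [h1]
  have h7 : p * (L ^ p / p + ‖a‖ ^ p * (1 - p⁻¹)) = L ^ p + p * ‖a‖ ^ p - ‖a‖ ^ p := by
    field_simp; ring
  rw [h7] at h6
  linarith

/-- An integrable majorant for the tested flux. Without it the vanishing integral could be the
default value for a non-integrable function. -/
theorem abs_inner_rpow_smul_le {E : Type*} [NormedAddCommGroup E] [InnerProductSpace ℝ E]
    {p L : ℝ} (hp : 1 < p) (hL : 0 ≤ L) (a b : E) (hb : ‖b‖ ≤ L) :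
    |inner ℝ (‖a‖ ^ (p - 2) • a) (a - b)| ≤ 2 * ‖a‖ ^ p + L ^ p := by
  have hp0 : 0 < p := by linarith
  rcases eq_or_ne a 0 with rfl | ha
  · simp only [norm_zero, smul_zero, inner_zero_left, abs_zero]
    positivity
  have hn : 0 < ‖a‖ := norm_pos_iff.2 ha
  have h4 : ‖a‖ ^ (p - 1) = ‖a‖ ^ (p - 2) * ‖a‖ := by
    rw [← Real.rpow_add_one hn.ne']; ring_nf
  have h5 : ‖a‖ ^ p = ‖a‖ ^ (p - 1) * ‖a‖ := by
    rw [← Real.rpow_add_one hn.ne']; ring_nf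
  have h6 : ‖a‖ ^ (p - 1) * L ≤ ‖a‖ ^ p + L ^ p := by
    rcases le_total ‖a‖ L with h | h
    · have : L ^ p = L ^ (p - 1) * L := by
        rw [← Real.rpow_add_one (hn.trans_le h).ne']; ring_nf
      have h' : ‖a‖ ^ (p - 1) * L ≤ L ^ (p - 1) * L := by gcongr
      rw [← this] at h'
      linarith [Real.rpow_nonneg hn.le p]
    · have h' : ‖a‖ ^ (p - 1) * L ≤ ‖a‖ ^ (p - 1) * ‖a‖ := by gcongr
      rw [← h5] at h'
      linarith [Real.rpow_nonneg hL p]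
  have h7 : ‖a - b‖ ≤ ‖a‖ + L := (norm_sub_le _ _).trans (by gcongr)
  calc |inner ℝ (‖a‖ ^ (p - 2) • a) (a - b)| ≤ ‖‖a‖ ^ (p - 2) • a‖ * ‖a - b‖ :=
        abs_real_inner_le_norm _ _
    _ = ‖a‖ ^ (p - 1) * ‖a - b‖ := by
        rw [norm_smul, Real.norm_of_nonneg (by positivity), h4]
    _ ≤ ‖a‖ ^ (p - 1) * (‖a‖ + L) := by gcongr
    _ ≤ _ := by rw [mul_add, ← h5]; linarith

/-- With v = u - g as test function the flux term integrates to zero, and `norm_rpow_le_inner_add`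
leaves ∫ ‖Du‖^p ≤ L^p |Ω|. -/
theorem IsWeakSolutionPLaplace.exists_gradient_bound {p : ℝ} (hp : 1 < p)
    (hΩ : volume (Ω : Set (EuclideanSpace ℝ (Fin d))) ≠ ∞)
    {g : EuclideanSpace ℝ (Fin d) → ℝ} {D : EuclideanSpace ℝ (Fin d) → EuclideanSpace ℝ (Fin d)}
    (hg : HasSobolevGradient Ω ∞ g D) {L : ℝ} (hL : 0 ≤ L)
    (hD : ∀ᵐ x ∂volume.restrict (Ω : Set (EuclideanSpace ℝ (Fin d))), ‖D x‖ ≤ L)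
    (hu : IsWeakSolutionPLaplace Ω p g u) :
    ∃ H, HasSobolevZeroGradient Ω (ENNReal.ofReal p) (fun x => u x - g x) H ∧
      (eLpNorm H (ENNReal.ofReal p)
        (volume.restrict (Ω : Set (EuclideanSpace ℝ (Fin d))))).toReal ≤
        2 * L * (volume (Ω : Set (EuclideanSpace ℝ (Fin d)))).toReal ^ (1 / p) := by
  have hp0 : 0 < p := by linarith
  have : IsFiniteMeasure (volume.restrict (Ω : Set (EuclideanSpace ℝ (Fin d)))) :=
    isFiniteMeasure_restrict.2 hΩ
  obtain ⟨⟨_, H, hH⟩, hw⟩ := hu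
  refine ⟨H, hH, ?_⟩
  set q := ENNReal.ofReal p with hq
  have hq1 : 1 ≤ q := by simpa [hq] using hp.le
  have hqp : q.toReal = p := ENNReal.toReal_ofReal hp0.le
  set μ := volume.restrict (Ω : Set (EuclideanSpace ℝ (Fin d))) with hμ
  set V := (volume (Ω : Set (EuclideanSpace ℝ (Fin d)))).toReal with hV
  have hgq : HasSobolevGradient Ω q g D := hg.mono_exponent hΩ le_top
  -- This version of Du makes H = G - D hold at every point, so uniqueness of weak gradients is not
  -- needed.
  have hG : HasSobolevGradient Ω q u (fun x => H x + D x) := by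
    simpa using hH.1.add hgq
  have h0 := hw _ hG _ _ hH
  set G := fun x => H x + D x with hGdef
  have hGp : Integrable (fun x => ‖G x‖ ^ p) μ := by
    have := hG.2.2.integrable_norm_rpow (by positivity) ENNReal.ofReal_ne_top
    rwa [hqp] at this
  have hHG : ∀ x, H x = G x - D x := fun x => by simp [hGdef]
  have hint : Integrable (fun x => inner ℝ (‖G x‖ ^ (p - 2) • G x) (H x)) μ := by
    refine ((hGp.const_mul 2).add (integrable_const (L ^ p))).mono' ?_ ?_
    · exact ((hG.2.2.1.norm.aemeasurable.pow_const _).aestronglyMeasurable.smul hG.2.2.1).inner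
        hH.1.2.2.1
    · filter_upwards [hD] with x hx
      rw [hHG x]
      exact abs_inner_rpow_smul_le hp hL _ _ hx
  have hbound : ∫ x, ‖G x‖ ^ p ∂μ ≤ L ^ p * V := by
    calc ∫ x, ‖G x‖ ^ p ∂μ
        ≤ ∫ x, (p * inner ℝ (‖G x‖ ^ (p - 2) • G x) (H x) + L ^ p) ∂μ := by
          refine integral_mono_ae hGp ((hint.const_mul p).add (integrable_const _)) ?_
          filter_upwards [hD] with x hx
          have := norm_rpow_le_inner_add hp hL (G x) (D x) hx
          rwa [← hHG x] at this
      _ = L ^ p * V := by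
          rw [integral_add (hint.const_mul p) (integrable_const _), integral_const_mul, h0,
            integral_const]
          simp [hμ, hV, Measure.real, mul_comm]
  have hGn : eLpNorm G q μ ≤ ENNReal.ofReal (L * V ^ (1 / p)) := by
    rw [hG.2.2.eLpNorm_eq_integral_rpow_norm (by positivity) ENNReal.ofReal_ne_top, hqp]
    refine ENNReal.ofReal_le_ofReal ?_
    calc (∫ x, ‖G x‖ ^ p ∂μ) ^ p⁻¹ ≤ (L ^ p * V) ^ p⁻¹ := by gcongr
      _ = _ := by
        rw [Real.mul_rpow (by positivity) ENNReal.toReal_nonneg, Real.rpow_rpow_inv hL hp0.ne',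
          one_div]
  have hDn : eLpNorm D q μ ≤ ENNReal.ofReal (L * V ^ (1 / p)) := by
    refine (eLpNorm_le_of_ae_bound hD).trans (le_of_eq ?_)
    rw [hqp, hμ, Measure.restrict_apply_univ, mul_comm, ENNReal.ofReal_mul hL, one_div,
      ← ENNReal.ofReal_rpow_of_nonneg ENNReal.toReal_nonneg (by positivity),
      ENNReal.ofReal_toReal hΩ]
  have hHn : eLpNorm H q μ ≤ ENNReal.ofReal (2 * L * V ^ (1 / p)) := by
    have : H = G - D := by ext1 x; exact hHG x
    rw [this]
    refine (eLpNorm_sub_le hG.2.2.1 hgq.2.2.1 hq1).trans ((add_le_add hGn hDn).trans (le_of_eq ?_))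
    rw [← ENNReal.ofReal_add (by positivity) (by positivity)]
    congr 1; ring
  exact ENNReal.toReal_le_of_le_ofReal (by positivity) hHn

end Sobolev

/-! ### Lipschitz functions are in W^{1,∞} -/

section Lipschitz

variable {d : ℕ} {Ω : Opens (EuclideanSpace ℝ (Fin d))}

/-- By Rademacher's theorem the default value 0 of `gradient` occurs only on a null set. Integration
by parts is then done direction by direction on the whole space, since φ vanishes off Ω. -/
theorem LipschitzWith.hasWeakGradient {w : EuclideanSpace ℝ (Fin d) → ℝ} {C : NNReal}
    (hw : LipschitzWith C w) : HasWeakGradient Ω w (gradient w) := by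
  have hgm : Measurable (gradient w) :=
    (InnerProductSpace.toDual ℝ _).symm.continuous.measurable.comp (measurable_fderiv ℝ w)
  have hgi : LocallyIntegrable (gradient w) volume := by
    refine MemLp.locallyIntegrable (p := ∞) ?_ le_top
    refine memLp_top_of_bound hgm.aestronglyMeasurable C (ae_of_all _ fun x => ?_)
    rw [norm_gradient_eq_norm_fderiv]
    exact norm_fderiv_le_of_lipschitz ℝ hw
  have hwi : LocallyIntegrable w volume := hw.continuous.locallyIntegrable
  refine ⟨hwi.locallyIntegrableOn _, hgi.locallyIntegrableOn _, fun φ => ?_⟩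
  have i1 := hwi.integrable_smul_right_of_hasCompactSupport φ.continuous_gradient
    φ.hasCompactSupport_gradient
  have i2 := hgi.integrable_smul_left_of_hasCompactSupport φ.continuous φ.hasCompactSupport
  rw [setIntegral_eq_integral_of_forall_compl_eq_zero, setIntegral_eq_integral_of_forall_compl_eq_zero]
  rotate_left
  · intro x hx; rw [φ.apply_eq_zero_of_notMem hx, zero_smul]
  · intro x hx; rw [φ.gradient_eq_zero_of_notMem hx, smul_zero]
  obtain ⟨K, hK⟩ := (φ.contDiff.of_le (m := 1) (by simp)).lipschitzWith_of_hasCompactSupport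
    φ.hasCompactSupport one_ne_zero
  refine ext_inner_left ℝ fun v => ?_
  rw [inner_neg_right, ← integral_inner i1, ← integral_inner i2, ← integral_neg]
  have h := integral_lineDeriv_mul_eq (μ := volume) hw hK φ.hasCompactSupport v
  have h1 : ∫ x, inner ℝ v (w x • gradient φ x) = -∫ x, lineDeriv ℝ φ x (-v) * w x := by
    rw [← integral_neg]
    refine integral_congr_ae (ae_of_all _ fun x => ?_)
    dsimp only
    rw [(φ.differentiable x).lineDeriv_eq_fderiv, map_neg, real_inner_smul_right,
      inner_gradient_right]
    simp; ring
  rw [h1, ← h, ← integral_neg]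
  refine integral_congr_ae ?_
  filter_upwards [hw.ae_differentiableAt (μ := volume)] with x hx
  rw [hx.lineDeriv_eq_fderiv, real_inner_smul_right, inner_gradient_right]
  simp; ring

theorem LipschitzWith.memSobolev_top {w : EuclideanSpace ℝ (Fin d) → ℝ} {C : NNReal}
    (hw : LipschitzWith C w) (hΩ : Bornology.IsBounded (Ω : Set (EuclideanSpace ℝ (Fin d)))) :
    MemSobolev Ω ∞ w := by
  have hgm : Measurable (gradient w) :=
    (InnerProductSpace.toDual ℝ _).symm.continuous.measurable.comp (measurable_fderiv ℝ w)
  refine ⟨gradient w, hw.hasWeakGradient, ?_, ?_⟩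
  · obtain ⟨M, hM⟩ := hΩ.isCompact_closure.exists_bound_of_continuousOn hw.continuous.continuousOn
    refine memLp_top_of_bound hw.continuous.aestronglyMeasurable M ?_
    filter_upwards [ae_restrict_mem Ω.isOpen.measurableSet] with x hx
    exact hM x (subset_closure hx)
  · refine memLp_top_of_bound hgm.aestronglyMeasurable C (ae_of_all _ fun x => ?_)
    rw [norm_gradient_eq_norm_fderiv]
    exact norm_fderiv_le_of_lipschitz ℝ hw

end Lipschitz

/-! ### A continuous representative of the boundary datum -/

section ContinuousRepresentative

variable {d : ℕ} {Ω : Opens (EuclideanSpace ℝ (Fin d))}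

open ContinuousLinearMap in
-- When the mollifier's ball about x lies in Ω, t ↦ η (x - t) is an admissible test function. The
-- derivative of the mollification is then a weighted average of D with total weight 1.
theorem HasWeakGradient.norm_fderiv_mollification_le
    {g : EuclideanSpace ℝ (Fin d) → ℝ} {D : EuclideanSpace ℝ (Fin d) → EuclideanSpace ℝ (Fin d)}
    (hg : HasWeakGradient Ω g D)
    (hgi : LocallyIntegrable ((Ω : Set (EuclideanSpace ℝ (Fin d))).indicator g) volume) {L : ℝ}
    (hD : ∀ᵐ x ∂volume.restrict (Ω : Set (EuclideanSpace ℝ (Fin d))), ‖D x‖ ≤ L)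
    (ψ : ContDiffBump (0 : EuclideanSpace ℝ (Fin d))) {x : EuclideanSpace ℝ (Fin d)}
    (hx : Metric.closedBall x ψ.rOut ⊆ Ω) :
    ∃ A : EuclideanSpace ℝ (Fin d) →L[ℝ] ℝ, HasFDerivAt
      (convolution (ψ.normed volume) ((Ω : Set (EuclideanSpace ℝ (Fin d))).indicator g)
        (lsmul ℝ ℝ) volume) A x ∧ ‖A‖ ≤ L := by
  set g₀ := (Ω : Set (EuclideanSpace ℝ (Fin d))).indicator g with hg₀
  set η := ψ.normed volume with hη
  have hηc : ContDiff ℝ (⊤ : ℕ∞) η := ψ.contDiff_normed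
  have hηs : HasCompactSupport η := ψ.hasCompactSupport_normed
  have hη1 : ContDiff ℝ 1 η := ψ.contDiff_normed
  have hder := hηs.hasFDerivAt_convolution_right (lsmul ℝ ℝ).flip hgi hη1 x
  rw [convolution_flip] at hder
  refine ⟨_, hder, ?_⟩
  have hηr : Continuous (fun t => η (x - t)) := hηc.continuous.comp (continuous_const.sub continuous_id)
  have hts : tsupport (fun t => η (x - t)) ⊆ Metric.closedBall x ψ.rOut := by
    refine closure_minimal (fun t ht => ?_) Metric.isClosed_closedBall
    have h1 : x - t ∈ Function.support η := ht
    rw [hη, ψ.support_normed_eq, mem_ball_zero_iff] at h1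
    rw [mem_closedBall_iff_norm, norm_sub_rev]; exact h1.le
  let φ : 𝓓(Ω, ℝ) := ⟨fun t => η (x - t), hηc.comp (contDiff_const.sub contDiff_id),
    HasCompactSupport.of_support_subset_isCompact (isCompact_closedBall x ψ.rOut)
      ((subset_tsupport _).trans hts), hts.trans hx⟩
  have hφ : ∀ t, φ t = η (x - t) := fun _ => rfl
  have hφg : ∀ t v, inner ℝ v (gradient φ t) = -fderiv ℝ η (x - t) v := by
    intro t v
    rw [inner_gradient_right]
    have h1 : HasFDerivAt φ ((fderiv ℝ η (x - t)).comp (-ContinuousLinearMap.id ℝ _)) t := by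
      exact HasFDerivAt.comp (g := η) (f := fun t => x - t) t
        ((hη1.differentiable one_ne_zero _).hasFDerivAt) ((hasFDerivAt_id t).const_sub x)
    rw [h1.fderiv]; simp
  have iD := integrableOn_smul_of_locallyIntegrableOn hg.2.1 φ.continuous
    φ.hasCompactSupport φ.tsupport_subset
  have ig := integrableOn_smul_of_locallyIntegrableOn' hg.1 φ.continuous_gradient
    φ.hasCompactSupport_gradient φ.tsupport_gradient_subset
  set I := ∫ t in (Ω : Set (EuclideanSpace ℝ (Fin d))), φ t • D t with hI
  have hηi : ∫ t, η (x - t) = 1 := by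
    rw [integral_sub_left_eq_self η volume x]; exact ψ.integral_normed
  have hηint : Integrable (fun t => η (x - t)) := ψ.integrable_normed.comp_sub_left x
  have hIn : ‖I‖ ≤ L := by
    have hL : 0 ≤ L ∨ I = 0 := by
      by_cases h : volume.restrict (Ω : Set (EuclideanSpace ℝ (Fin d))) = 0
      · right; rw [hI, h, integral_zero_measure]
      · left
        have : (ae (volume.restrict (Ω : Set (EuclideanSpace ℝ (Fin d))))).NeBot := ae_neBot.2 h
        obtain ⟨y, hy⟩ := hD.exists
        exact (norm_nonneg _).trans hy
    calc ‖I‖ ≤ ∫ t in (Ω : Set (EuclideanSpace ℝ (Fin d))), η (x - t) * L := by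
          refine norm_integral_le_of_norm_le (hηint.integrableOn.mul_const L) ?_
          filter_upwards [hD] with t ht
          rw [norm_smul, hφ, Real.norm_of_nonneg (ψ.nonneg_normed _)]
          exact mul_le_mul_of_nonneg_left ht (ψ.nonneg_normed _)
      _ = ∫ t, η (x - t) * L := by
          refine setIntegral_eq_integral_of_forall_compl_eq_zero fun t ht => ?_
          rw [← hφ, φ.apply_eq_zero_of_notMem ht, zero_mul]
      _ = L := by rw [integral_mul_const, hηi, one_mul]
  have hA : ∀ v, (convolution g₀ (fderiv ℝ η) ((lsmul ℝ ℝ).flip.precompR _) volume x) v =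
      inner ℝ v I := by
    intro v
    rw [convolution_precompR_apply _ hgi (hηs.fderiv ℝ) (hη1.continuous_fderiv one_ne_zero)]
    rw [convolution_def]
    have h1 : inner ℝ v I = -inner ℝ v (∫ t in (Ω : Set (EuclideanSpace ℝ (Fin d))),
        g t • gradient φ t) := by rw [hg.2.2 φ, inner_neg_right, neg_neg]
    rw [h1, ← integral_inner ig, ← integral_neg, ← integral_indicator Ω.isOpen.measurableSet]
    refine integral_congr_ae (ae_of_all _ fun t => ?_)
    by_cases ht : t ∈ (Ω : Set (EuclideanSpace ℝ (Fin d)))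
    · simp only [hg₀, Set.indicator_of_mem ht, real_inner_smul_right, hφg]
      simp [mul_comm]
    · simp [hg₀, Set.indicator_of_notMem ht]
  refine ContinuousLinearMap.opNorm_le_bound _ ((norm_nonneg _).trans hIn) fun v => ?_
  rw [hA v]
  refine (norm_inner_le_norm v I).trans ?_
  rw [mul_comm]; gcongr

/-- On small balls inside Ω the mollifications are eventually L-Lipschitz, and the bound passes to g
on the dense set S where they converge to it. The function g restricted to S then extends
continuously to Ω. -/
theorem HasSobolevGradient.exists_continuousOn_representative
    (hΩ : volume (Ω : Set (EuclideanSpace ℝ (Fin d))) ≠ ∞)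
    {g : EuclideanSpace ℝ (Fin d) → ℝ} {D : EuclideanSpace ℝ (Fin d) → EuclideanSpace ℝ (Fin d)}
    (hg : HasSobolevGradient Ω ∞ g D) {L : ℝ} (hL : 0 ≤ L)
    (hD : ∀ᵐ x ∂volume.restrict (Ω : Set (EuclideanSpace ℝ (Fin d))), ‖D x‖ ≤ L) :
    ∃ g' : EuclideanSpace ℝ (Fin d) → ℝ,
      ContinuousOn g' (Ω : Set (EuclideanSpace ℝ (Fin d))) ∧
      g' =ᵐ[volume.restrict (Ω : Set (EuclideanSpace ℝ (Fin d)))] g := by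
  have hfin : IsFiniteMeasure (volume.restrict (Ω : Set (EuclideanSpace ℝ (Fin d)))) :=
    isFiniteMeasure_restrict.2 hΩ
  set g₀ := (Ω : Set (EuclideanSpace ℝ (Fin d))).indicator g with hg₀
  have hgi : LocallyIntegrable g₀ volume := by
    refine Integrable.locallyIntegrable ?_
    rw [hg₀, integrable_indicator_iff Ω.isOpen.measurableSet]
    exact hg.2.1.integrable le_top
  -- The ratio of outer to inner radius is fixed at 2, since almost everywhere convergence requires
  -- it to be bounded.
  let ψ : ℕ → ContDiffBump (0 : EuclideanSpace ℝ (Fin d)) := fun k =>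
    ⟨1 / ((k : ℝ) + 1) / 2, 1 / ((k : ℝ) + 1), by positivity, half_lt_self (by positivity)⟩
  have hψ : Tendsto (fun k => (ψ k).rOut) atTop (𝓝 0) := tendsto_one_div_add_atTop_nhds_zero_nat
  have hconv := ContDiffBump.ae_convolution_tendsto_right_of_locallyIntegrable (K := 2) hψ
    (Eventually.of_forall fun k => by simp only [ψ]; linarith) hgi
  set T := {x | Tendsto (fun i => convolution ((ψ i).normed volume) g₀
    (ContinuousLinearMap.lsmul ℝ ℝ) volume x) atTop (𝓝 (g₀ x))} with hT
  have hTd : Dense T := Measure.dense_of_ae hconv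
  set S := (Ω : Set (EuclideanSpace ℝ (Fin d))) ∩ T with hS
  have hcl : (Ω : Set (EuclideanSpace ℝ (Fin d))) ⊆ closure S :=
    hTd.open_subset_closure_inter Ω.isOpen
  have key : ∀ x ∈ (Ω : Set (EuclideanSpace ℝ (Fin d))), ∃ h : EuclideanSpace ℝ (Fin d) → ℝ,
      Continuous h ∧ g₀ =ᶠ[𝓝[S] x] h ∧ (x ∈ S → g₀ x = h x) := by
    intro x hx
    obtain ⟨r, hr, hrΩ⟩ := Metric.nhds_basis_closedBall.mem_iff.1 (Ω.isOpen.mem_nhds hx)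
    have hlip : LipschitzOnWith L.toNNReal g₀ (S ∩ Metric.ball x (r / 2)) := by
      refine LipschitzOnWith.of_dist_le_mul fun y hy z hz => ?_
      rw [Real.coe_toNNReal _ hL]
      refine le_of_tendsto (hy.1.2.dist hz.1.2) ?_
      filter_upwards [hψ.eventually (gt_mem_nhds (half_pos hr))] with k hk
      have hb : ∀ a ∈ Metric.ball x (r / 2), Metric.closedBall a (ψ k).rOut ⊆ Ω := fun a ha =>
        (Metric.closedBall_subset_closedBall' (by
          rw [Metric.mem_ball] at ha; linarith)).trans hrΩ
      choose! A hA1 hA2 using fun a (ha : a ∈ Metric.ball x (r / 2)) =>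
        hg.1.norm_fderiv_mollification_le hgi hD (ψ k) (hb a ha)
      rw [dist_eq_norm, dist_eq_norm]
      exact (convex_ball x (r / 2)).norm_image_sub_le_of_norm_hasFDerivWithin_le
        (fun a ha => (hA1 a ha).hasFDerivWithinAt) hA2 hz.2 hy.2
    -- A Lipschitz extension to the whole space supplies the limit along S even at points x outside
    -- S.
    obtain ⟨h, hh, heq⟩ := hlip.extend_real
    refine ⟨h, hh.continuous, ?_, fun hxS => heq ⟨hxS, Metric.mem_ball_self (half_pos hr)⟩⟩
    filter_upwards [self_mem_nhdsWithin,
      mem_nhdsWithin_of_mem_nhds (Metric.ball_mem_nhds x (half_pos hr))] with y hy hy'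
    exact heq ⟨hy, hy'⟩
  have key' : ∀ x ∈ (Ω : Set (EuclideanSpace ℝ (Fin d))), ∃ y, Tendsto g₀ (𝓝[S] x) (𝓝 y) ∧
      (x ∈ S → g₀ x = y) := by
    intro x hx
    obtain ⟨h, hc, he, hxe⟩ := key x hx
    exact ⟨h x, ((hc.tendsto x).mono_left nhdsWithin_le_nhds).congr' he.symm, hxe⟩
  refine ⟨extendFrom S g₀, continuousOn_extendFrom hcl fun x hx => ?_, ?_⟩
  · obtain ⟨y, hy, _⟩ := key' x hx
    exact ⟨y, hy⟩
  · filter_upwards [ae_restrict_mem Ω.isOpen.measurableSet, ae_restrict_of_ae hconv] with x hx hxT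
    obtain ⟨y, hy, hxy⟩ := key' x hx
    rw [extendFrom_eq (hcl hx) hy, ← hxy ⟨hx, hxT⟩, hg₀, Set.indicator_of_mem hx]

end ContinuousRepresentative

/-! ### Arzelà–Ascoli with varying Hölder exponents -/

section Compactness

/-- Provides one modulus of continuity valid for all exponents in [1/2, 1]. -/
theorem Real.rpow_le_sqrt_add_self {t a : ℝ} (ht : 0 ≤ t) (ha : 1 / 2 ≤ a) (ha1 : a ≤ 1) :
    t ^ a ≤ √t + t := by
  rcases le_total t 1 with h | h
  · rcases ht.eq_or_lt with rfl | h0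
    · simp [Real.zero_rpow (by linarith : a ≠ 0)]
    · have := Real.rpow_le_rpow_of_exponent_ge h0 h ha
      rw [← Real.sqrt_eq_rpow] at this
      linarith
  · have := Real.rpow_le_rpow_of_exponent_le h ha1
    rw [Real.rpow_one] at this
    linarith [Real.sqrt_nonneg t]

theorem Real.rpow_le_max_one_self {t a : ℝ} (ht : 0 ≤ t) (ha : 0 ≤ a) (ha1 : a ≤ 1) :
    t ^ a ≤ max 1 t := by
  rcases le_total t 1 with h | h
  · exact (Real.rpow_le_one ht h ha).trans (le_max_left _ _)
  · have := Real.rpow_le_rpow_of_exponent_le h ha1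
    rw [Real.rpow_one] at this
    exact this.trans (le_max_right _ _)

/-- Functions vanishing off a compact set that are Hölder continuous with exponents tending to `1`
and a common constant have a uniformly convergent subsequence, whose limit is Lipschitz. -/
theorem exists_subseq_tendstoUniformlyOn_of_holder {E : Type*} [NormedAddCommGroup E] {K : Set E}
    (hK : IsCompact K) {w : ℕ → E → ℝ} (hwK : ∀ n, ∀ x ∉ K, w n x = 0) {y₀ : E}
    (hy₀ : ∀ n, w n y₀ = 0) {a : ℕ → ℝ} (ha : ∀ n, 1 / 2 ≤ a n) (ha1 : ∀ n, a n ≤ 1)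
    (hlim : Tendsto a atTop (𝓝 1)) {A : ℝ} (hA : 0 ≤ A)
    (hw : ∀ n x y, |w n x - w n y| ≤ A * ‖x - y‖ ^ a n) :
    ∃ (k : ℕ → ℕ) (w' : E → ℝ), StrictMono k ∧ LipschitzWith A.toNNReal w' ∧
      TendstoUniformlyOn (fun j => w (k j)) w' atTop K := by
  have : CompactSpace K := isCompact_iff_compactSpace.1 hK
  set b : ℝ → ℝ := fun t => A * (√t + t) with hb
  have hbc : Continuous b := by fun_prop
  have hb0 : Tendsto b (𝓝 0) (𝓝 0) := by
    have := hbc.tendsto 0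
    simpa [hb] using this
  have hmod : ∀ n x y, dist (w n x) (w n y) ≤ b (dist x y) := fun n x y => by
    rw [Real.dist_eq, dist_eq_norm]
    exact (hw n x y).trans (mul_le_mul_of_nonneg_left
      (Real.rpow_le_sqrt_add_self (norm_nonneg _) (ha n) (ha1 n)) hA)
  have heq : Equicontinuous w := Metric.equicontinuous_of_continuity_modulus b hb0 w
    fun x y n => hmod n x y
  let f : ℕ → BoundedContinuousFunction K ℝ := fun n =>
    BoundedContinuousFunction.mkOfCompact ⟨fun x => w n x, (heq.continuous n).comp continuous_subtype_val⟩
  -- The common zero y₀ turns the modulus of continuity into the uniform bound b R on K.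
  obtain ⟨R, hR⟩ := hK.isBounded.subset_closedBall y₀
  have hcomp : IsCompact (closure (Set.range f)) := by
    refine BoundedContinuousFunction.arzela_ascoli (Metric.closedBall 0 (b R))
      (isCompact_closedBall _ _) _ ?_ ?_
    · rintro _ x ⟨n, rfl⟩
      have h1 := hmod n x y₀
      rw [hy₀ n] at h1
      have h2 : dist (x : E) y₀ ≤ R := hR x.2
      refine h1.trans ?_
      simp only [hb]; gcongr
    · refine Metric.equicontinuous_of_continuity_modulus b hb0 _ ?_
      rintro x y ⟨_, n, rfl⟩
      exact hmod n x y
  obtain ⟨F, -, k, hk, hF⟩ := hcomp.tendsto_subseq fun n => subset_closure (Set.mem_range_self n)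
  rw [BoundedContinuousFunction.tendsto_iff_tendstoUniformly, Metric.tendstoUniformly_iff] at hF
  classical
  -- Extension by zero matches the vanishing of every w n off K, so convergence is pointwise on all
  -- of E and the limit is globally Lipschitz.
  set w' : E → ℝ := fun x => if h : x ∈ K then F ⟨x, h⟩ else 0 with hw'
  have hu : TendstoUniformlyOn (fun j => w (k j)) w' atTop K := by
    rw [Metric.tendstoUniformlyOn_iff]
    intro ε hε
    filter_upwards [hF ε hε] with n hn x hx
    have := hn ⟨x, hx⟩
    simp only [hw', dif_pos hx]
    exact this
  have hp : ∀ x, Tendsto (fun j => w (k j) x) atTop (𝓝 (w' x)) := by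
    intro x
    by_cases hx : x ∈ K
    · exact hu.tendsto_at hx
    · simp only [hw', dif_neg hx, fun n => hwK n x hx, tendsto_const_nhds_iff]
  refine ⟨k, w', hk, LipschitzWith.of_dist_le_mul fun x y => ?_, hu⟩
  rw [Real.coe_toNNReal _ hA]
  rcases eq_or_ne x y with rfl | hxy
  · simp
  rw [Real.dist_eq, dist_eq_norm]
  have hne : ‖x - y‖ ≠ 0 := norm_ne_zero_iff.2 (sub_ne_zero.2 hxy)
  have h1 : Tendsto (fun j => A * ‖x - y‖ ^ a (k j)) atTop (𝓝 (A * ‖x - y‖)) := by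
    have h2 := ((Real.continuousAt_const_rpow hne (b := 1)).tendsto.comp
      (hlim.comp hk.tendsto_atTop)).const_mul A
    simpa using h2
  exact le_of_tendsto_of_tendsto' (((hp x).sub (hp y)).abs) h1 fun j => hw (k j) x y

end Compactness

/-! ### The limit p → ∞ -/

theorem mainTheorem2 (d : ℕ) (hd : 1 ≤ d)
    (Ω : Opens (EuclideanSpace ℝ (Fin d)))
    (hΩ : Bornology.IsBounded (Ω : Set (EuclideanSpace ℝ (Fin d))))
    (g : EuclideanSpace ℝ (Fin d) → ℝ) (hg : MemSobolev Ω ∞ g)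
    (p : ℕ → ℝ) (hp1 : ∀ n, 1 < p n) (hp : Tendsto p atTop atTop)
    (u : ℕ → EuclideanSpace ℝ (Fin d) → ℝ)
    (hu : ∀ n, IsWeakSolutionPLaplace Ω (p n) g (u n)) :
    ∃ (k : ℕ → ℕ) (v : ℕ → EuclideanSpace ℝ (Fin d) → ℝ)
      (uInf : EuclideanSpace ℝ (Fin d) → ℝ),
      StrictMono k ∧
      (∀ j, v j =ᵐ[volume.restrict (Ω : Set (EuclideanSpace ℝ (Fin d)))] u (k j)) ∧
      (∀ j, ContinuousOn (v j) (Ω : Set (EuclideanSpace ℝ (Fin d)))) ∧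
      ContinuousOn uInf (Ω : Set (EuclideanSpace ℝ (Fin d))) ∧
      MemSobolev Ω ∞ uInf ∧
      TendstoUniformlyOn v uInf atTop (Ω : Set (EuclideanSpace ℝ (Fin d))) := by
  have : NeZero d := ⟨by lia⟩
  have hd0 : (0 : ℝ) < d := by exact_mod_cast hd
  have hvol : volume (Ω : Set (EuclideanSpace ℝ (Fin d))) ≠ ∞ := hΩ.measure_lt_top.ne
  obtain ⟨D, hD⟩ := hg
  set L := (eLpNorm D ∞ (volume.restrict (Ω : Set (EuclideanSpace ℝ (Fin d))))).toReal with hL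
  have hL0 : 0 ≤ L := ENNReal.toReal_nonneg
  have hDL : ∀ᵐ x ∂volume.restrict (Ω : Set (EuclideanSpace ℝ (Fin d))), ‖D x‖ ≤ L := by
    filter_upwards [ae_le_eLpNormEssSup (f := D)
      (μ := volume.restrict (Ω : Set (EuclideanSpace ℝ (Fin d))))] with x hx
    rw [← eLpNorm_exponent_top] at hx
    have := ENNReal.toReal_mono hD.2.2.2.ne hx
    rwa [toReal_enorm] at this
  obtain ⟨g', hg'c, hg'⟩ := hD.exists_continuousOn_representative hvol hL0 hDL
  obtain ⟨y₀, hy₀⟩ : ∃ y₀, y₀ ∉ Ω := by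
    by_contra! h
    have huniv : (Ω : Set (EuclideanSpace ℝ (Fin d))) = Set.univ := Set.eq_univ_of_forall h
    rw [huniv] at hΩ
    exact NormedSpace.unbounded_univ ℝ (EuclideanSpace ℝ (Fin d)) hΩ
  -- p ≥ 2d gives both p > d and a Hölder exponent of at least 1/2.
  obtain ⟨N, hN⟩ := eventually_atTop.1 (hp.eventually_ge_atTop (2 * d))
  have hpN : ∀ n, 2 * (d : ℝ) ≤ p (n + N) := fun n => hN _ (Nat.le_add_left _ _)
  choose H hH hHb using fun n =>
    (hu (n + N)).exists_gradient_bound (hp1 (n + N)) hvol hD hL0 hDL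
  choose w hwv hw0 hw using fun n => (hH n).exists_holder_representative (hp1 (n + N)).le
    (by linarith [hpN n]) hy₀
  set ω := (volume (Metric.ball (0 : EuclideanSpace ℝ (Fin d)) 1)).toReal with hω
  set V := (volume (Ω : Set (EuclideanSpace ℝ (Fin d)))).toReal with hV
  have hω0 : 0 ≤ ω := ENNReal.toReal_nonneg
  have hV0 : 0 ≤ V := ENNReal.toReal_nonneg
  -- 6 bounds 3/(1 - d/p) because 1 - d/p ≥ 1/2. The two maxima bound ω^(-1/p) and V^(1/p) uniformly
  -- in p, and 2L comes from the energy estimate.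
  set A := 6 * max 1 ω⁻¹ * (2 * L * max 1 V) with hAdef
  have hA : 0 ≤ A := by positivity
  have ha : ∀ n, 1 / 2 ≤ 1 - d / p (n + N) := fun n => by
    have h1 := hpN n
    have : d / p (n + N) ≤ 1 / 2 := by
      rw [div_le_div_iff₀ (by linarith) two_pos]; linarith
    linarith
  have ha1 : ∀ n, 1 - d / p (n + N) ≤ 1 := fun n => by
    have : 0 ≤ d / p (n + N) := div_nonneg hd0.le (by linarith [hp1 (n + N)])
    linarith
  have hlim : Tendsto (fun n => 1 - d / p (n + N)) atTop (𝓝 1) := by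
    have h1 : Tendsto (fun n => p (n + N)) atTop atTop := hp.comp (tendsto_add_atTop_nat N)
    simpa using (h1.const_div_atTop (d : ℝ)).const_sub 1
  have hholder : ∀ n x y, |w n x - w n y| ≤ A * ‖x - y‖ ^ (1 - d / p (n + N)) := by
    intro n x y
    have hpos : 0 < p (n + N) := by linarith [hp1 (n + N)]
    have hinv0 : 0 ≤ 1 / p (n + N) := by positivity
    have hinv1 : 1 / p (n + N) ≤ 1 := by
      rw [div_le_one hpos]; exact (hp1 (n + N)).le
    have h1 : 3 / (1 - d / p (n + N)) ≤ 6 := by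
      rw [div_le_iff₀ (by linarith [ha n])]; linarith [ha n]
    have h2 : ω ^ (-(1 / p (n + N))) ≤ max 1 ω⁻¹ := by
      rw [Real.rpow_neg hω0, ← Real.inv_rpow hω0]
      exact Real.rpow_le_max_one_self (inv_nonneg.2 hω0) hinv0 hinv1
    have h3 : V ^ (1 / p (n + N)) ≤ max 1 V := Real.rpow_le_max_one_self hV0 hinv0 hinv1
    have h4 : 0 ≤ 1 - d / p (n + N) := by linarith [ha n]
    calc |w n x - w n y| ≤ _ := hw n x y
      _ ≤ 6 * max 1 ω⁻¹ * ‖x - y‖ ^ (1 - d / p (n + N)) * (2 * L * max 1 V) := by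
          gcongr
          exact (hHb n).trans (by gcongr)
      _ = _ := by rw [hAdef]; ring
  obtain ⟨k, w', hk, hlip, hunif⟩ := exists_subseq_tendstoUniformlyOn_of_holder
    hΩ.isCompact_closure (fun n x hx => hw0 n x fun h => hx (subset_closure h))
    (fun n => hw0 n y₀ hy₀) ha ha1 hlim hA hholder
  have hwc : ∀ n, Continuous (w n) := fun n => by
    have hexp : 0 < 1 - d / p (n + N) := by linarith [ha n]
    refine continuous_iff_continuousAt.2 fun x => ?_
    rw [ContinuousAt, tendsto_iff_dist_tendsto_zero]
    have h1 : Tendsto (fun y => A * ‖y - x‖ ^ (1 - d / p (n + N))) (𝓝 x) (𝓝 0) := by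
      have h2 : Continuous (fun y => A * ‖y - x‖ ^ (1 - d / p (n + N))) :=
        continuous_const.mul ((continuous_id.sub continuous_const).norm.rpow_const
          fun _ => Or.inr hexp.le)
      simpa [Real.zero_rpow hexp.ne'] using h2.tendsto x
    exact squeeze_zero (fun _ => dist_nonneg) (fun y => hholder n y x) h1
  -- The shift by N undoes the discarding of the small exponents.
  refine ⟨fun j => k j + N, fun j x => w (k j) x + g' x, fun x => w' x + g' x,
    fun i j hij => Nat.add_lt_add_right (hk hij) N, fun j => ?_,
    fun j => (hwc _).continuousOn.add hg'c, hlip.continuous.continuousOn.add hg'c, ?_, ?_⟩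
  · filter_upwards [hwv (k j), hg'] with x hx hx'
    rw [hx, hx']; ring
  · obtain ⟨D', hD'⟩ := hlip.memSobolev_top hΩ
    exact ⟨_, hD'.add (hD.congr hg'.symm)⟩
  · rw [Metric.tendstoUniformlyOn_iff] at hunif ⊢
    intro ε hε
    filter_upwards [hunif ε hε] with j hj x hx
    simpa using hj x (subset_closure hx)
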